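/- Let $d\ge 1$, $H_d=\sum_{n=1}^d \frac1n$, and let $|\Psi_d^+\rangle=\frac1{\sqrt d}\sum_{i=0}^{d-1}|i\rangle|i\rangle\in\mathbb C^d\otimes\mathbb C^d$. Definitions (steering). Let $F=\{F_{a|x}\}$ be a finite family of positive semidefinite $d\times d$ matrices, where $x$ labels Alice's measurement settings and $a$ her outcomes. An assemblage $\{\sigma_{a|x}\}$ of $d\times d$ matrices is unsteerable (LHS) if $\sigma_{a|x}=\int p(a|x,\lambda)\,\sigma_\lambda\,d\mu(\lambda)$ for all $a,x$, for some probability measure $\mu$, conditional distributions $p(\cdot|x,\lambda)$ and density matrices $\sigma_\lambda$. Put $\omega_s(F)=\sup_{\sigma\in\mathrm{LHS}}\sum_{a,x}\mathrm{tr}(F_{a|x}\sigma_{a|x})$ and $$LV_s^\pi(|\Psi_d^+\rangle,F)=\sup_{\{E_{a|x}\}}\frac1{\omega_s(F)}\sum_{a,x}\mathrm{tr}(F_{a|x}\sigma_{a|x}),\qquad \sigma_{a|x}=\mathrm{tr}_A\big[|\Psi_d^+\rangle\langle\Psi_d^+|\,(E_{a|x}\otimes\mathbb I)\big],$$ where the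 supremum is over all families of projective measurements $\{E_{a|x}\}_a$ on $\mathbb C^d$, one for each $x$. Definitions (Bell). Let $B=\{B_{ab|xy}\}$ be a finite family of non-negative real numbers. A correlation is Bell-local (LHV) if $P(a,b|x,y)=\int p(a|x,\lambda)\,q(b|y,\lambda)\,d\mu(\lambda)$ for some probability measure $\mu$ and conditional distributions $p,q$. Put $\omega(B)=\sup_{P\in\mathrm{LHV}}\sum_{a,b,x,y} B_{ab|xy}P(a,b|x,y)$ and $$LV^\pi(|\Psi_d^+\rangle,B)=\sup\frac1{\omega(B)}\sum_{a,b,x,y} B_{ab|xy}\,\langle\Psi_d^+|E_{a|x}\otimes E_{b|y}|\Psi_d^+\rangle,$$ where the supremum is over all projective measurements $\{E_{a|x}\}_a$ and $\{E_{b|y}\}_b$ of the two parties on $\mathbb C^d$. Theorem. For every $d\ge1$: (i) For every such $F$ the suprema $\omega_s(F)$ and $LV_s^\pi(|\Psi_d^+\rangle,F)$ are finite, $\omega_s(F)>0$ unless all $F_{a|x}=0$, and $$LV_s^\pi(|\Psi_d^+\rangle,F)\le\frac{d^2}{H_d+H_d\,d-d}.$$ (ii) This bound scales as $d/\ln d$: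 $\ \frac{d^2}{H_d+H_d d-d}\Big/\frac{d}{\ln d}\to1$ as $d\to\infty$. (iii) For every such $B$ the suprema $\omega(B)$ and $LV^\pi(|\Psi_d^+\rangle,B)$ are finite, $\omega(B)>0$ unless $B=0$, and $$LV^\pi(|\Psi_d^+\rangle,B)\le\frac{d^2}{H_d+H_d\,d-d}.$$ (In the degenerate cases $F=0$ and $B=0$ the quotients are read as $0$.) -/

import Mathlib

open scoped Matrix Kronecker ComplexOrder

noncomputable section

namespace Steering

open MeasureTheory

/-- `p` is a probability distribution on the finite set `A`. -/
def IsDistribution {A : Type*} [Fintype A] (p : A → ℝ) : Prop :=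
  (∀ a, 0 ≤ p a) ∧ ∑ a, p a = 1

/-- Density matrices: positive semidefinite with unit trace. -/
def IsDensityMatrix {n : Type*} [Fintype n] (s : Matrix n n ℂ) : Prop :=
  s.PosSemidef ∧ s.trace = 1

/-- A projective measurement with outcomes in `A`: mutually orthogonal (self-adjoint)
projections, of any rank, which sum to the identity. -/
structure IsProjectiveMeasurement {n A : Type*} [Fintype n] [DecidableEq n] [Fintype A]
    (E : A → Matrix n n ℂ) : Prop where
  proj : ∀ a, IsStarProjection (E a)
  orthogonal : ∀ a b, a ≠ b → E a * E b = 0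
  sum_eq_one : ∑ a, E a = 1

/-- The partial trace over the first tensor factor. -/
def partialTraceA {m n : Type*} [Fintype m] (M : Matrix (m × n) (m × n) ℂ) : Matrix n n ℂ :=
  Matrix.of fun j k => ∑ i, M (i, j) (i, k)

/-- The vector `|Ψ_d⁺⟩ = d^{-1/2} ∑ i, |i⟩|i⟩` in `ℂ^d ⊗ ℂ^d`. -/
def maxEntangledVec (d : ℕ) : Fin d × Fin d → ℂ :=
  fun q => if q.1 = q.2 then (((Real.sqrt d)⁻¹ : ℝ) : ℂ) else 0

/-- The density matrix `|Ψ_d⁺⟩⟨Ψ_d⁺|`. -/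
def maxEntangled (d : ℕ) : Matrix (Fin d × Fin d) (Fin d × Fin d) ℂ :=
  Matrix.vecMulVec (maxEntangledVec d) (star (maxEntangledVec d))

section SteeringInequalities

variable {m n X A : Type*} [Fintype m] [DecidableEq m] [Fintype n] [DecidableEq n]
  [Fintype X] [Fintype A]

/-- The assemblage `σ_{a|x} = tr_A [ρ (E_{a|x} ⊗ 1)]` on the second factor (Bob) which arises
from the measurements `E x` on the first factor (Alice). -/
def assemblage (ρ : Matrix (m × n) (m × n) ℂ) (E : X → A → Matrix m m ℂ) :
    X → A → Matrix n n ℂ :=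
  fun x a => partialTraceA (ρ * (E x a ⊗ₖ (1 : Matrix n n ℂ)))

/-- The assemblage `σ` admits a local-hidden-state model: for a hidden variable `l` with law `μ`,
response functions `p(a|x,l)` and hidden states `s_l`, one has
`σ_{a|x} = ∫ p(a|x,l) s_l dμ(l)` (entrywise). -/
def IsLHS (σ : X → A → Matrix n n ℂ) : Prop :=
  ∃ (L : Type) (_ : MeasurableSpace L) (μ : Measure L) (p : L → X → A → ℝ)
    (s : L → Matrix n n ℂ),
    IsProbabilityMeasure μ ∧
    (∀ x a, Measurable fun l => p l x a) ∧
    (∀ l x, IsDistribution (p l x)) ∧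
    (∀ i j, Measurable fun l => s l i j) ∧
    (∀ l, IsDensityMatrix (s l)) ∧
    ∀ x a i j, σ x a i j = ∫ l, ((p l x a : ℝ) : ℂ) * s l i j ∂μ

/-- The steering functional `∑_{a,x} tr (F_{a|x} σ_{a|x})` (the trace is real for Hermitian
matrices). -/
def steeringValue (F σ : X → A → Matrix n n ℂ) : ℝ :=
  ∑ x, ∑ a, (F x a * σ x a).trace.re

/-- The values which the steering functional takes on unsteerable assemblages. -/
def lhsValues (F : X → A → Matrix n n ℂ) : Set ℝ :=
  {r | ∃ σ : X → A → Matrix n n ℂ, IsLHS σ ∧ r = steeringValue F σ}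

/-- The steering bound `ω_s(F)`. -/
def steeringBound (F : X → A → Matrix n n ℂ) : ℝ :=
  sSup (lhsValues F)

/-- The steering fraction `Γ_s(σ, F)`. -/
def steeringFraction (σ F : X → A → Matrix n n ℂ) : ℝ :=
  1 / steeringBound F * steeringValue F σ

/-- The steering fractions which Alice's projective measurements on `ρ` can produce. -/
def projSteeringFractions (ρ : Matrix (m × n) (m × n) ℂ) (F : X → A → Matrix n n ℂ) : Set ℝ :=
  {r | ∃ E : X → A → Matrix m m ℂ, (∀ x, IsProjectiveMeasurement (E x)) ∧
    r = steeringFraction (assemblage ρ E) F}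

/-- The largest steering-inequality violation of `ρ` under projective measurements,
`LV_s^π(ρ, F)`. -/
def projSteeringViolation (ρ : Matrix (m × n) (m × n) ℂ) (F : X → A → Matrix n n ℂ) : ℝ :=
  sSup (projSteeringFractions ρ F)

end SteeringInequalities

section BellInequalities

variable {m n X Y A B : Type*} [Fintype m] [DecidableEq m] [Fintype n] [DecidableEq n]
  [Fintype X] [Fintype Y] [Fintype A] [Fintype B]

/-- The correlation `P(a,b|x,y) = P x y a b` admits a local-hidden-variable model. -/
def IsLHV (P : X → Y → A → B → ℝ) : Prop :=
  ∃ (L : Type) (_ : MeasurableSpace L) (μ : Measure L) (p : L → X → A → ℝ)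
    (q : L → Y → B → ℝ),
    IsProbabilityMeasure μ ∧
    (∀ x a, Measurable fun l => p l x a) ∧
    (∀ l x, IsDistribution (p l x)) ∧
    (∀ y b, Measurable fun l => q l y b) ∧
    (∀ l y, IsDistribution (q l y)) ∧
    ∀ x y a b, P x y a b = ∫ l, p l x a * q l y b ∂μ

/-- The correlation `P(a,b|x,y) = tr [ρ (E_{a|x} ⊗ E_{b|y})]`. -/
def quantumCorrelation (ρ : Matrix (m × n) (m × n) ℂ) (EA : X → A → Matrix m m ℂ)
    (EB : Y → B → Matrix n n ℂ) : X → Y → A → B → ℝ :=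
  fun x y a b => (ρ * (EA x a ⊗ₖ EB y b)).trace.re

/-- The Bell functional `∑_{a,b,x,y} β_{ab|xy} P(a,b|x,y)`. -/
def bellValue (β P : X → Y → A → B → ℝ) : ℝ :=
  ∑ x, ∑ y, ∑ a, ∑ b, β x y a b * P x y a b

/-- The values which the Bell functional takes on Bell-local correlations. -/
def lhvValues (β : X → Y → A → B → ℝ) : Set ℝ :=
  {r | ∃ P : X → Y → A → B → ℝ, IsLHV P ∧ r = bellValue β P}

/-- The local bound `ω(β)`. -/
def localBound (β : X → Y → A → B → ℝ) : ℝ :=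
  sSup (lhvValues β)

/-- The nonlocality fraction `Γ(P, β)`. -/
def nonlocalityFraction (P β : X → Y → A → B → ℝ) : ℝ :=
  1 / localBound β * bellValue β P

/-- The nonlocality fractions which local projective measurements on `ρ` can produce. -/
def projNonlocalityFractions (ρ : Matrix (m × n) (m × n) ℂ) (β : X → Y → A → B → ℝ) : Set ℝ :=
  {r | ∃ (EA : X → A → Matrix m m ℂ) (EB : Y → B → Matrix n n ℂ),
    (∀ x, IsProjectiveMeasurement (EA x)) ∧ (∀ y, IsProjectiveMeasurement (EB y)) ∧
    r = nonlocalityFraction (quantumCorrelation ρ EA EB) β}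

/-- The largest Bell-inequality violation of `ρ` under projective measurements, `LV^π(ρ, β)`. -/
def projBellViolation (ρ : Matrix (m × n) (m × n) ℂ) (β : X → Y → A → B → ℝ) : ℝ :=
  sSup (projNonlocalityFractions ρ β)

end BellInequalities

/-- `d² / (H_d + H_d d - d)`, where `H_d` is the `d`-th harmonic number. -/
def violationBound (d : ℕ) : ℝ :=
  (d : ℝ) ^ 2 / ((harmonic d : ℝ) + (harmonic d : ℝ) * d - d)

end Steering

end

open scoped Matrix Kronecker ComplexOrder

noncomputable section

namespace Steering

open MeasureTheory

/-! A Gaussian vector `z` in `ℂ^d` serves as an unnormalised pure hidden state. If Alice's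
measurement `x` is diagonal in the orthonormal basis `U x`, she answers with the outcome of the
basis vector that has the largest overlap with `z`. For each fixed `z` this is a deterministic
strategy, so its value is at most `W |z|²`, where `W` is the classical bound, and the mean of `|z|²`
is `d`.

Conversely, the `|z i|²` are independent exponential variables of mean one. Their maximum has mean
`H_d`, so by symmetry `|z i|²` integrates to `H_d / d` over the event that coordinate `i` dominates
(`lintegral_dominantSet_norm_sq`). By unitary invariance the same holds in every basis. A sign flip
cancels the cross terms and positivity discards the other coordinates
(`diag_mul_le_lintegral_dominantSet`), which leaves at least `H_d / d` times the diagonal entry that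
the quantum value contains. Comparison (`sum_quadForm_col_mul_le`) bounds the quantum value by `W d
/ H_d`; this implies the stated bound because `H_d ≤ d`.

In the Bell case Bob's measurements turn the functional into a steering functional, and Born's rule
on the hidden state gives him a local response. The same estimate (`projective_value_le`) therefore
applies with `W` the local bound. -/

/-! ### Radial integrals of the complex Gaussian -/

/-- The standard Gaussian measure on `ℂ`, normalised so that `|z|²` has mean one. -/
def complexGaussian : Measure ℂ :=
  volume.withDensity fun z => ENNReal.ofReal (Real.pi⁻¹ * Real.exp (-‖z‖ ^ 2))

lemma measurable_complexGaussian_density :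
    Measurable fun z : ℂ => ENNReal.ofReal (Real.pi⁻¹ * Real.exp (-‖z‖ ^ 2)) := by
  fun_prop

/-- Polar coordinates: the circumference `2πr` cancels the normalisation `1/π`, so `‖z‖` has density
`2r exp(-r²)`. -/
lemma lintegral_complexGaussian_norm {h : ℝ → ℝ} (hm : Measurable h) (h0 : ∀ r, 0 ≤ h r)
    (hi : IntegrableOn (fun r => 2 * r * Real.exp (-r ^ 2) * h r) (Set.Ioi 0)) :
    ∫⁻ z, ENNReal.ofReal (h ‖z‖) ∂complexGaussian
      = ENNReal.ofReal (∫ r in Set.Ioi 0, 2 * r * Real.exp (-r ^ 2) * h r) := by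
  rw [complexGaussian, lintegral_withDensity_eq_lintegral_mul _ (by fun_prop) (by fun_prop)]
  have hp : ∀ z : ℂ, 0 ≤ Real.pi⁻¹ * Real.exp (-‖z‖ ^ 2) := fun z => by positivity
  have e : ∀ z : ℂ, ((fun z : ℂ => ENNReal.ofReal (Real.pi⁻¹ * Real.exp (-‖z‖ ^ 2))) *
      fun z : ℂ => ENNReal.ofReal (h ‖z‖)) z
      = ENNReal.ofReal (Real.pi⁻¹ * Real.exp (-‖z‖ ^ 2) * h ‖z‖) := fun z => by
    rw [Pi.mul_apply, ← ENNReal.ofReal_mul (hp z)]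
  simp_rw [e]
  rw [← ofReal_integral_eq_lintegral_ofReal]
  · congr 1
    rw [integral_fun_norm_addHaar volume fun r => Real.pi⁻¹ * Real.exp (-r ^ 2) * h r]
    have hb : volume.real (Metric.ball (0 : ℂ) 1) = Real.pi := by
      simp [Measure.real, Complex.volume_ball]
    rw [hb, Complex.finrank_real_complex, nsmul_eq_mul, smul_eq_mul, ← mul_assoc,
      ← integral_const_mul]
    refine setIntegral_congr_fun measurableSet_Ioi fun r _ => ?_
    have := Real.pi_pos.ne'
    simp only [smul_eq_mul]
    field_simp
    simp
    ring
  · rw [integrable_fun_norm_addHaar volume (f := fun r => Real.pi⁻¹ * Real.exp (-r ^ 2) * h r),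
      Complex.finrank_real_complex]
    refine (hi.const_mul (Real.pi⁻¹ / 2)).congr (ae_of_all _ fun r => ?_)
    simp only [smul_eq_mul]
    ring
  · exact ae_of_all _ fun z => mul_nonneg (hp z) (h0 _)

lemma lintegral_complexGaussian_norm_of_hasDerivAt {h G : ℝ → ℝ} {l : ℝ} (hm : Measurable h)
    (h0 : ∀ r, 0 ≤ h r) (hG : ∀ r, HasDerivAt G (2 * r * Real.exp (-r ^ 2) * h r) r)
    (hG0 : G 0 = 0) (hl : Filter.Tendsto G Filter.atTop (nhds l)) :
    ∫⁻ z, ENNReal.ofReal (h ‖z‖) ∂complexGaussian = ENNReal.ofReal l := by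
  have hpos : ∀ r ∈ Set.Ioi (0 : ℝ), 0 ≤ 2 * r * Real.exp (-r ^ 2) * h r := fun r hr => by
    have := h0 r
    have : (0 : ℝ) < r := hr
    positivity
  rw [lintegral_complexGaussian_norm hm h0
    (integrableOn_Ioi_deriv_of_nonneg' (fun r _ => hG r) hpos hl),
    integral_Ioi_of_hasDerivAt_of_nonneg' (fun r _ => hG r) hpos hl, hG0, sub_zero]

lemma hasDerivAt_exp_neg_sq (r : ℝ) :
    HasDerivAt (fun r : ℝ => Real.exp (-r ^ 2)) (-(2 * r * Real.exp (-r ^ 2))) r := by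
  refine ((hasDerivAt_pow 2 r).fun_neg).exp.congr_deriv ?_
  push_cast
  ring

lemma tendsto_exp_neg_sq : Filter.Tendsto (fun r : ℝ => Real.exp (-r ^ 2)) Filter.atTop (nhds 0) :=
  Real.tendsto_exp_atBot.comp
    (Filter.tendsto_neg_atTop_atBot.comp (Filter.tendsto_pow_atTop two_ne_zero))

instance : IsProbabilityMeasure complexGaussian := ⟨by
  have := lintegral_complexGaussian_norm_of_hasDerivAt (h := fun _ => 1)
    (G := fun r => 1 - Real.exp (-r ^ 2)) (l := 1) measurable_const (fun _ => zero_le_one)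
    (fun r => by simpa using (hasDerivAt_exp_neg_sq r).const_sub 1) (by simp)
    (by simpa using tendsto_exp_neg_sq.const_sub 1)
  simpa using this⟩

/-- This is the distribution function of the exponential variable `|z|²`, evaluated at `s²`. -/
lemma complexGaussian_ball {s : ℝ} (hs : 0 ≤ s) :
    complexGaussian (Metric.ball 0 s) = ENNReal.ofReal (1 - Real.exp (-s ^ 2)) := by
  have hc : Continuous fun r : ℝ => 2 * r * Real.exp (-r ^ 2) := by fun_prop
  have hind : (fun r : ℝ => 2 * r * Real.exp (-r ^ 2) * (Set.Iio s).indicator 1 r)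
      = (Set.Iio s).indicator fun r : ℝ => 2 * r * Real.exp (-r ^ 2) := by
    ext r
    by_cases hr : r < s <;> simp [hr]
  have key := lintegral_complexGaussian_norm (h := (Set.Iio s).indicator 1)
    (measurable_one.indicator measurableSet_Iio)
    (fun r => Set.indicator_nonneg (fun _ _ => zero_le_one) r) (by
      rw [hind, IntegrableOn, integrable_indicator_iff measurableSet_Iio, IntegrableOn,
        Measure.restrict_restrict measurableSet_Iio]
      exact (hc.integrableOn_Icc (a := 0) (b := s)).mono_set
        fun r hr => ⟨le_of_lt hr.2, le_of_lt hr.1⟩)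
  rw [hind, setIntegral_indicator measurableSet_Iio, Set.Ioi_inter_Iio,
    ← integral_Ioc_eq_integral_Ioo, ← intervalIntegral.integral_of_le hs,
    intervalIntegral.integral_eq_sub_of_hasDerivAt (f := fun r => - Real.exp (-r ^ 2))
      (fun r _ => by simpa using (hasDerivAt_exp_neg_sq r).fun_neg)
      (hc.intervalIntegrable _ _)] at key
  rw [← lintegral_indicator_one Metric.isOpen_ball.measurableSet]
  convert key using 2
  · ext z
    by_cases hz : ‖z‖ < s <;> simp [hz]
  · simp
    ring

lemma lintegral_complexGaussian_norm_sq :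
    ∫⁻ z, ENNReal.ofReal (‖z‖ ^ 2) ∂complexGaussian = 1 := by
  have ht : Filter.Tendsto (fun r : ℝ => r ^ 2 * Real.exp (-r ^ 2)) Filter.atTop (nhds 0) := by
    have := (Real.tendsto_pow_mul_exp_neg_atTop_nhds_zero 1).comp
      (Filter.tendsto_pow_atTop (α := ℝ) two_ne_zero)
    simpa [Function.comp_def] using this
  rw [lintegral_complexGaussian_norm_of_hasDerivAt (h := fun r => r ^ 2)
    (G := fun r => 1 - Real.exp (-r ^ 2) - r ^ 2 * Real.exp (-r ^ 2)) (l := 1) (by fun_prop)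
    (fun r => sq_nonneg r) (fun r => ((hasDerivAt_exp_neg_sq r).const_sub 1).fun_sub
      ((hasDerivAt_pow 2 r).fun_mul (hasDerivAt_exp_neg_sq r)) |>.congr_deriv ?_) (by simp) ?_,
    ENNReal.ofReal_one]
  · simpa using (tendsto_exp_neg_sq.const_sub 1).sub ht
  · push_cast
    ring

/-- The mean of `t` on the event that `n` further independent exponential variables are below
`t`, for an exponential variable `t = |z|²`. -/
lemma lintegral_complexGaussian_norm_sq_mul_pow (n : ℕ) :
    ∫⁻ z, ENNReal.ofReal (‖z‖ ^ 2 * (1 - Real.exp (-‖z‖ ^ 2)) ^ n) ∂complexGaussian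
      = ENNReal.ofReal (harmonic (n + 1) / (n + 1)) := by
  have hle : ∀ r : ℝ, 0 ≤ 1 - Real.exp (-r ^ 2) := fun r => by
    have : Real.exp (-r ^ 2) ≤ 1 := Real.exp_le_one_iff.mpr (by nlinarith [sq_nonneg r])
    linarith
  have ht : Filter.Tendsto (fun r : ℝ => r ^ 2 * (1 - (1 - Real.exp (-r ^ 2)) ^ (n + 1)))
      Filter.atTop (nhds 0) := by
    have h1 : Filter.Tendsto (fun r : ℝ => r ^ 2 * Real.exp (-r ^ 2)) Filter.atTop (nhds 0) := by
      have := (Real.tendsto_pow_mul_exp_neg_atTop_nhds_zero 1).comp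
        (Filter.tendsto_pow_atTop (α := ℝ) two_ne_zero)
      simpa [Function.comp_def] using this
    refine squeeze_zero (g := fun r : ℝ => (n + 1 : ℝ) * (r ^ 2 * Real.exp (-r ^ 2)))
      (fun r => ?_) (fun r => ?_) (by simpa using h1.const_mul (n + 1 : ℝ))
    · exact mul_nonneg (sq_nonneg r) (sub_nonneg.mpr (pow_le_one₀ (hle r)
        (by linarith [Real.exp_pos (-r ^ 2)])))
    -- Bernoulli's inequality gives `1 - (1 - e)^(n+1) ≤ (n+1) e` for `e = exp(-r²)`.
    · have := one_add_mul_le_pow (a := -Real.exp (-r ^ 2)) (by linarith [hle r]) (n + 1)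
      rw [← sub_eq_add_neg] at this
      push_cast at this
      nlinarith [sq_nonneg r]
  have hs : Filter.Tendsto (fun r : ℝ => ∑ k ∈ Finset.range (n + 1),
      (1 - Real.exp (-r ^ 2)) ^ (k + 1) / (k + 1)) Filter.atTop (nhds (harmonic (n + 1) : ℝ)) := by
    have : (harmonic (n + 1) : ℝ) = ∑ k ∈ Finset.range (n + 1), ((1 - 0 : ℝ)) ^ (k + 1) / (k + 1) := by
      simp [harmonic]
    rw [this]
    exact tendsto_finsetSum _ fun k _ => ((tendsto_exp_neg_sq.const_sub 1).pow _).div_const _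
  -- The primitive comes from integration by parts with `u = 1 - exp(-r²)`: the integrand is `r²
  -- d(u^(n+1))/(n+1)`, and the remaining `2r (1 - u^(n+1))` equals `u' ∑ u^k` by the geometric sum.
  refine lintegral_complexGaussian_norm_of_hasDerivAt
    (h := fun r => r ^ 2 * (1 - Real.exp (-r ^ 2)) ^ n)
    (G := fun r => (∑ k ∈ Finset.range (n + 1), (1 - Real.exp (-r ^ 2)) ^ (k + 1) / (k + 1)
      - r ^ 2 * (1 - (1 - Real.exp (-r ^ 2)) ^ (n + 1))) / (n + 1)) (by fun_prop)
    (fun r => mul_nonneg (sq_nonneg r) (pow_nonneg (hle r) n)) (fun r => ?_) (by simp) ?_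
  · have hd : ∀ k : ℕ, HasDerivAt (fun r : ℝ => (1 - Real.exp (-r ^ 2)) ^ (k + 1))
        ((k + 1) * (1 - Real.exp (-r ^ 2)) ^ k * (2 * r * Real.exp (-r ^ 2))) r := fun k => by
      simpa using ((hasDerivAt_exp_neg_sq r).const_sub 1).fun_pow (k + 1)
    have hsum : HasDerivAt (fun r : ℝ => ∑ k ∈ Finset.range (n + 1),
        (1 - Real.exp (-r ^ 2)) ^ (k + 1) / (k + 1))
        (2 * r * (1 - (1 - Real.exp (-r ^ 2)) ^ (n + 1))) r := by
      refine (HasDerivAt.fun_sum (u := Finset.range (n + 1))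
        fun k _ => (hd k).div_const ((k : ℝ) + 1)).congr_deriv ?_
      have := geom_sum_mul_neg (1 - Real.exp (-r ^ 2)) (n + 1)
      rw [← this, Finset.sum_mul, Finset.mul_sum]
      refine Finset.sum_congr rfl fun k _ => ?_
      have : (k : ℝ) + 1 ≠ 0 := by positivity
      field_simp
      ring
    refine ((hsum.fun_sub ((hasDerivAt_pow 2 r).fun_mul
      ((hd n).const_sub 1))).div_const (n + 1 : ℝ)).congr_deriv ?_
    have : (n : ℝ) + 1 ≠ 0 := by positivity
    push_cast
    field_simp
    ring
  · simpa using (hs.sub ht).div_const (n + 1 : ℝ)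

/-! ### The Gaussian measure on `ℂ^d` and its unitary invariance -/

lemma lintegral_fin_prod {α : Type*} [MeasureSpace α] [SigmaFinite (volume : Measure α)] {n : ℕ}
    {f : Fin n → α → ENNReal} (hf : ∀ i, Measurable (f i)) :
    ∫⁻ x : Fin n → α, ∏ i, f i (x i) = ∏ i, ∫⁻ x, f i x := by
  induction n with
  | zero => simp [volume_pi]
  | succ n ih =>
    have hm : ∀ {m : ℕ} {g : Fin m → α → ENNReal}, (∀ i, Measurable (g i)) →
        Measurable fun x : Fin m → α => ∏ i, g i (x i) := fun hg =>
      Finset.measurable_prod _ fun i _ => (hg i).comp (measurable_pi_apply i)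
    rw [← (volume_preserving_piFinSuccAbove (fun _ : Fin (n + 1) => α) 0).symm.lintegral_comp
      (hm hf)]
    simp only [MeasurableEquiv.piFinSuccAbove_symm_apply, Fin.insertNthEquiv, Fin.prod_univ_succ]
    rw [← ih fun i => hf i.succ, ← lintegral_prod_mul (hf 0).aemeasurable
      (hm fun i => hf i.succ).aemeasurable]
    rfl

/-- The standard Gaussian measure on `ℂ^d`. -/
def complexGaussianPi (d : ℕ) : Measure (Fin d → ℂ) := Measure.pi fun _ => complexGaussian

instance (d : ℕ) : IsProbabilityMeasure (complexGaussianPi d) := by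
  unfold complexGaussianPi
  infer_instance

lemma complexGaussianPi_eq_withDensity (d : ℕ) :
    complexGaussianPi d = volume.withDensity fun z : Fin d → ℂ =>
      ENNReal.ofReal (Real.pi⁻¹ ^ d * Real.exp (-∑ i, ‖z i‖ ^ 2)) := by
  refine Measure.pi_eq fun s hs => ?_
  rw [withDensity_apply _ (MeasurableSet.univ_pi hs),
    ← lintegral_indicator (MeasurableSet.univ_pi hs)]
  simp only [complexGaussian, fun i => withDensity_apply (μ := (volume : Measure ℂ))
    (fun z => ENNReal.ofReal (Real.pi⁻¹ * Real.exp (-‖z‖ ^ 2))) (hs i)]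
  simp_rw [← lintegral_indicator (hs _)]
  rw [← lintegral_fin_prod fun i => measurable_complexGaussian_density.indicator (hs i)]
  congr 1
  ext z
  by_cases hz : z ∈ Set.univ.pi s
  · rw [Set.indicator_of_mem hz, Finset.prod_congr rfl fun i _ =>
      Set.indicator_of_mem (hz i (Set.mem_univ i)) _,
      ← ENNReal.ofReal_prod_of_nonneg fun i _ => by positivity, Finset.prod_mul_distrib,
      ← Real.exp_sum]
    simp
  · rw [Set.indicator_of_notMem hz]
    obtain ⟨i, hi⟩ : ∃ i, z i ∉ s i := by simpa [Set.mem_pi] using hz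
    exact (Finset.prod_eq_zero (Finset.mem_univ i) (Set.indicator_of_notMem hi _)).symm

lemma sum_norm_sq_eq_dotProduct {n : Type*} [Fintype n] (z : n → ℂ) :
    ∑ i, ‖z i‖ ^ 2 = (star z ⬝ᵥ z).re := by
  simp [dotProduct, ← Complex.normSq_eq_norm_sq, Complex.normSq_apply]

lemma star_mulVec_dotProduct_mulVec {n : Type*} [Fintype n] [DecidableEq n] {U : Matrix n n ℂ}
    (hU : U ∈ Matrix.unitaryGroup n ℂ) (z w : n → ℂ) :
    star (U *ᵥ z) ⬝ᵥ (U *ᵥ w) = star z ⬝ᵥ w := by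
  rw [Matrix.star_mulVec, Matrix.dotProduct_mulVec, Matrix.vecMul_vecMul,
    ← Matrix.star_eq_conjTranspose, Matrix.mem_unitaryGroup_iff'.mp hU, Matrix.vecMul_one]

/-- As a real linear map, `U` has determinant `|det U|² = 1`. -/
lemma measurePreserving_volume_unitary {n : Type*} [Fintype n] [DecidableEq n] {U : Matrix n n ℂ}
    (hU : U ∈ Matrix.unitaryGroup n ℂ) :
    MeasurePreserving (fun z : n → ℂ => U *ᵥ z) volume volume := by
  have hd : ‖U.det‖ = 1 := by
    have h := Unitary.star_mul_self_of_mem (Matrix.det_of_mem_unitary hU)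
    have h2 : ‖U.det‖ * ‖U.det‖ = 1 := by simpa using congrArg norm h
    nlinarith [norm_nonneg U.det]
  obtain ⟨L, hL, hdet⟩ : ∃ L : (n → ℂ) →ₗ[ℝ] (n → ℂ), ⇑L = (fun z => U *ᵥ z) ∧
      LinearMap.det L = 1 := by
    refine ⟨(Matrix.toLin' U).restrictScalars ℝ, rfl, ?_⟩
    rw [LinearMap.det_restrictScalars, LinearMap.det_toLin', Algebra.norm_complex_apply,
      Complex.normSq_eq_norm_sq, hd, one_pow]
  have := Measure.map_linearMap_addHaar_eq_smul_addHaar (volume : Measure (n → ℂ)) (f := L)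
    (by rw [hdet]; exact one_ne_zero)
  rw [hdet, hL] at this
  refine ⟨?_, by simpa using this⟩
  rw [← hL]
  exact L.continuous_of_finiteDimensional.measurable

/-- Lebesgue measure is invariant, and the Gaussian density depends only on `|z|²`. -/
lemma lintegral_complexGaussianPi_unitary {d : ℕ} {U : Matrix (Fin d) (Fin d) ℂ}
    (hU : U ∈ Matrix.unitaryGroup (Fin d) ℂ) {f : (Fin d → ℂ) → ENNReal} (hf : Measurable f) :
    ∫⁻ z, f (U *ᵥ z) ∂complexGaussianPi d = ∫⁻ z, f z ∂complexGaussianPi d := by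
  have hm : Measurable fun z : Fin d → ℂ =>
      ENNReal.ofReal (Real.pi⁻¹ ^ d * Real.exp (-∑ i, ‖z i‖ ^ 2)) := by fun_prop
  have hp := measurePreserving_volume_unitary hU
  have hfU : Measurable fun z => f (U *ᵥ z) := hf.comp hp.measurable
  rw [complexGaussianPi_eq_withDensity, lintegral_withDensity_eq_lintegral_mul _ hm hf,
    lintegral_withDensity_eq_lintegral_mul _ hm hfU,
    ← hp.lintegral_comp (hm.mul hf)]
  simp only [Pi.mul_apply, sum_norm_sq_eq_dotProduct,
    star_mulVec_dotProduct_mulVec hU]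

lemma lintegral_complexGaussianPi_norm_sq (d : ℕ) (i : Fin d) :
    ∫⁻ z, ENNReal.ofReal (‖z i‖ ^ 2) ∂complexGaussianPi d = 1 := by
  rw [← lintegral_complexGaussian_norm_sq]
  exact (measurePreserving_eval (fun _ : Fin d => complexGaussian) i).lintegral_comp
    (f := fun z : ℂ => ENNReal.ofReal (‖z‖ ^ 2)) (by fun_prop)

/-! ### The event that one coordinate dominates -/

/-- The vectors whose `i`-th coordinate is strictly the largest in absolute value. -/
def dominantSet {d : ℕ} (i : Fin d) : Set (Fin d → ℂ) := {z | ∀ j, j ≠ i → ‖z j‖ < ‖z i‖}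

lemma measurableSet_dominantSet {d : ℕ} (i : Fin d) : MeasurableSet (dominantSet i) := by
  simp only [dominantSet, Set.ofPred_forall]
  exact MeasurableSet.iInter fun j => MeasurableSet.iInter fun _ =>
    measurableSet_lt (by fun_prop) (by fun_prop)

/-- Once coordinate `i` is fixed at `z`, the event asks the `n` others to lie independently in the
ball of radius `‖z‖`, which has probability `(1 - exp(-‖z‖²))^n`. -/
lemma lintegral_dominantSet_norm_sq (n : ℕ) (i : Fin (n + 1)) :
    ∫⁻ z in dominantSet i, ENNReal.ofReal (‖z i‖ ^ 2) ∂complexGaussianPi (n + 1)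
      = ENNReal.ofReal (harmonic (n + 1) / (n + 1)) := by
  have hms := measurableSet_dominantSet i
  have hm : Measurable ((dominantSet i).indicator fun z => ENNReal.ofReal (‖z i‖ ^ 2)) :=
    Measurable.indicator (by fun_prop) hms
  have hp := (measurePreserving_piFinSuccAbove (fun _ : Fin (n + 1) => complexGaussian) i).symm
  have hmp : Measurable fun q : ℂ × (Fin n → ℂ) => (dominantSet i).indicator
      (fun z => ENNReal.ofReal (‖z i‖ ^ 2)) ((MeasurableEquiv.piFinSuccAbove (fun _ => ℂ) i).symm q) :=
    hm.comp hp.measurable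
  rw [← lintegral_indicator hms, complexGaussianPi, ← hp.lintegral_comp hm,
    lintegral_prod _ hmp.aemeasurable,
    ← lintegral_complexGaussian_norm_sq_mul_pow]
  refine lintegral_congr fun z => ?_
  have e : ∀ w : Fin n → ℂ, (dominantSet i).indicator (fun z => ENNReal.ofReal (‖z i‖ ^ 2))
      ((MeasurableEquiv.piFinSuccAbove (fun _ => ℂ) i).symm (z, w))
      = (Set.univ.pi fun _ => Metric.ball (0 : ℂ) ‖z‖).indicator
        (fun _ => ENNReal.ofReal (‖z‖ ^ 2)) w := fun w => by
    have hmem : (MeasurableEquiv.piFinSuccAbove (fun _ => ℂ) i).symm (z, w) ∈ dominantSet i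
        ↔ w ∈ Set.univ.pi fun _ => Metric.ball (0 : ℂ) ‖z‖ := by
      simp [dominantSet, MeasurableEquiv.piFinSuccAbove_symm_apply, Fin.insertNthEquiv,
        Fin.forall_iff_succAbove i]
    by_cases hw : w ∈ Set.univ.pi fun _ => Metric.ball (0 : ℂ) ‖z‖
    · rw [Set.indicator_of_mem hw, Set.indicator_of_mem (hmem.mpr hw)]
      simp [MeasurableEquiv.piFinSuccAbove_symm_apply, Fin.insertNthEquiv]
    · rw [Set.indicator_of_notMem hw, Set.indicator_of_notMem (mt hmem.mp hw)]
  simp_rw [e]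
  rw [lintegral_indicator_const (MeasurableSet.univ_pi fun _ => measurableSet_ball),
    Measure.pi_pi, complexGaussian_ball (norm_nonneg z), Finset.prod_const, Finset.card_univ,
    Fintype.card_fin, ENNReal.ofReal_mul (sq_nonneg _),
    ENNReal.ofReal_pow (p := 1 - Real.exp (-‖z‖ ^ 2))
      (sub_nonneg.mpr (Real.exp_le_one_iff.mpr (neg_nonpos.mpr (sq_nonneg _))))]

/-! ### Quadratic forms averaged over a dominant event -/

lemma measurable_quadForm {n : Type*} [Fintype n] (M : Matrix n n ℂ) :
    Measurable fun z : n → ℂ => ENNReal.ofReal (star z ⬝ᵥ M *ᵥ z).re := by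
  have : Continuous fun z : n → ℂ => (star z ⬝ᵥ M *ᵥ z).re := by fun_prop
  exact this.measurable.ennreal_ofReal

/-- The sign flip of the `i`-th coordinate. -/
def signFlip {n : Type*} [DecidableEq n] (i : n) : Matrix n n ℂ :=
  Matrix.diagonal fun j => if j = i then -1 else 1

lemma signFlip_mem_unitaryGroup {n : Type*} [Fintype n] [DecidableEq n] (i : n) :
    signFlip i ∈ Matrix.unitaryGroup n ℂ := by
  rw [Matrix.mem_unitaryGroup_iff, signFlip, Matrix.star_eq_conjTranspose,
    Matrix.diagonal_conjTranspose, Matrix.diagonal_mul_diagonal, ← Matrix.diagonal_one]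
  congr 1
  ext j
  by_cases h : j = i <;> simp [h]

lemma norm_signFlip_mulVec {n : Type*} [Fintype n] [DecidableEq n] (i j : n) (z : n → ℂ) :
    ‖(signFlip i *ᵥ z) j‖ = ‖z j‖ := by
  rw [signFlip, Matrix.mulVec_diagonal]
  by_cases h : j = i <;> simp [h]

/-- With `z = w + u`, where `u` is the `i`-th component, the flipped vector is `w - u`. The cross
terms cancel in the sum, and the form at `w` is nonnegative. -/
lemma two_mul_diag_le_quadForm_add {n : Type*} [Fintype n] [DecidableEq n] {M : Matrix n n ℂ}
    (hM : M.PosSemidef) (i : n) (z : n → ℂ) :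
    2 * (‖z i‖ ^ 2 * (M i i).re) ≤ (star z ⬝ᵥ M *ᵥ z).re +
      (star (signFlip i *ᵥ z) ⬝ᵥ M *ᵥ (signFlip i *ᵥ z)).re := by
  obtain ⟨w, hw⟩ : ∃ w, w = z - Pi.single i (z i) := ⟨_, rfl⟩
  have h1 : z = w + Pi.single i (z i) := by rw [hw, sub_add_cancel]
  have h2 : signFlip i *ᵥ z = w - Pi.single i (z i) := by
    ext j
    rw [hw, signFlip, Matrix.mulVec_diagonal]
    by_cases h : j = i
    · subst h
      simp
    · simp [h]
  have h3 : (star (Pi.single i (z i)) ⬝ᵥ M *ᵥ Pi.single i (z i)) = (‖z i‖ ^ 2 : ℝ) * M i i := by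
    rw [Pi.star_single, single_dotProduct, Matrix.mulVec_single, Pi.smul_apply]
    simp only [Matrix.col_apply, MulOpposite.smul_eq_mul_unop, MulOpposite.unop_op]
    rw [← Complex.normSq_eq_norm_sq, ← Complex.mul_conj]
    simp only [Complex.star_def]
    ring
  have h4 := (Complex.le_def.mp (hM.dotProduct_mulVec_nonneg w)).1
  have h5 := congrArg Complex.re h3
  rw [Complex.re_ofReal_mul] at h5
  generalize (Pi.single i (z i) : n → ℂ) = u at h1 h2 h5
  rw [h2, ← h5, h1]
  simp only [star_add, star_sub, Matrix.mulVec_add, Matrix.mulVec_sub, add_dotProduct,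
    sub_dotProduct, dotProduct_add, dotProduct_sub, Complex.add_re, Complex.sub_re]
  simp only [Complex.zero_re] at h4
  linarith

/-- The Gaussian measure and the dominant event are both invariant under the sign flip, so the
integrand may be averaged with its flipped copy; the factor 2 in `hle` counts the two copies. -/
lemma diag_mul_le_lintegral_dominantSet {n : ℕ} {M : Matrix (Fin (n + 1)) (Fin (n + 1)) ℂ}
    (hM : M.PosSemidef) (i : Fin (n + 1)) :
    ENNReal.ofReal ((M i i).re * (harmonic (n + 1) / (n + 1))) ≤
      ∫⁻ z in dominantSet i, ENNReal.ofReal (star z ⬝ᵥ M *ᵥ z).re ∂complexGaussianPi (n + 1) := by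
  have hms := measurableSet_dominantSet i
  have hMi : 0 ≤ (M i i).re := (Complex.le_def.mp hM.diag_nonneg).1
  set f : (Fin (n + 1) → ℂ) → ENNReal :=
    (dominantSet i).indicator fun z => ENNReal.ofReal (star z ⬝ᵥ M *ᵥ z).re with hf
  have hfm : Measurable f := (measurable_quadForm M).indicator hms
  have hflip := lintegral_complexGaussianPi_unitary (signFlip_mem_unitaryGroup i) hfm
  rw [← lintegral_indicator hms, ← hf]
  have hle : 2 * ENNReal.ofReal ((M i i).re * (harmonic (n + 1) / (n + 1))) ≤
      2 * ∫⁻ z, f z ∂complexGaussianPi (n + 1) := by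
    calc 2 * ENNReal.ofReal ((M i i).re * (harmonic (n + 1) / (n + 1)))
        = ∫⁻ z in dominantSet i, 2 * ENNReal.ofReal (M i i).re * ENNReal.ofReal (‖z i‖ ^ 2)
            ∂complexGaussianPi (n + 1) := by
          rw [lintegral_const_mul _ (by fun_prop), lintegral_dominantSet_norm_sq,
            ENNReal.ofReal_mul hMi, mul_assoc]
      _ ≤ ∫⁻ z, (f z + f (signFlip i *ᵥ z)) ∂complexGaussianPi (n + 1) := by
          rw [← lintegral_indicator hms]
          refine lintegral_mono fun z => ?_
          by_cases hz : z ∈ dominantSet i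
          · have hz' : signFlip i *ᵥ z ∈ dominantSet i := by
              simpa only [dominantSet, Set.mem_ofPred_eq, norm_signFlip_mulVec] using hz
            simp only [hf, Set.indicator_of_mem hz, Set.indicator_of_mem hz']
            rw [← ENNReal.ofReal_add (Complex.le_def.mp (hM.dotProduct_mulVec_nonneg _)).1
              (Complex.le_def.mp (hM.dotProduct_mulVec_nonneg _)).1, mul_assoc,
              ← ENNReal.ofReal_mul hMi, ← ENNReal.ofReal_ofNat 2,
              ← ENNReal.ofReal_mul zero_le_two]
            refine ENNReal.ofReal_le_ofReal ?_
            rw [mul_comm (M i i).re]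
            exact two_mul_diag_le_quadForm_add hM i z
          · rw [Set.indicator_of_notMem hz]
            exact zero_le
      _ = 2 * ∫⁻ z, f z ∂complexGaussianPi (n + 1) := by
          rw [lintegral_add_left hfm, hflip, two_mul]
  exact (ENNReal.mul_le_mul_iff_right two_ne_zero ENNReal.ofNat_ne_top).mp hle

lemma eq_of_mem_dominantSet {d : ℕ} {i j : Fin d} {z : Fin d → ℂ} (hi : z ∈ dominantSet i)
    (hj : z ∈ dominantSet j) : i = j := by
  by_contra h
  exact lt_asymm (hi j (Ne.symm h)) (hj i h)

/-! ### The hidden-variable estimate -/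

/-- If, for every vector `z` and every choice of one matrix per setting `x`, the quadratic forms at
`z` add up to at most `W |z|²`, then so do, on average, those at the vectors of orthonormal bases. -/
theorem sum_quadForm_col_mul_le {n : ℕ} {X : Type*} [Fintype X]
    {F : X → Fin (n + 1) → Matrix (Fin (n + 1)) (Fin (n + 1)) ℂ} (hF : ∀ x i, (F x i).PosSemidef)
    {U : X → Matrix (Fin (n + 1)) (Fin (n + 1)) ℂ} (hU : ∀ x, U x ∈ Matrix.unitaryGroup _ ℂ)
    {W : ℝ} (hW0 : 0 ≤ W)
    (hW : ∀ (f : X → Fin (n + 1)) (z : Fin (n + 1) → ℂ),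
      ∑ x, (star z ⬝ᵥ F x (f x) *ᵥ z).re ≤ W * ∑ i, ‖z i‖ ^ 2) :
    (∑ x, ∑ i, (((U x)ᴴ * F x i * U x) i i).re) * (harmonic (n + 1) / (n + 1)) ≤ W * (n + 1) := by
  have hq : ∀ x i z, 0 ≤ (star z ⬝ᵥ F x i *ᵥ z).re := fun x i z =>
    (Complex.le_def.mp ((hF x i).dotProduct_mulVec_nonneg z)).1
  have hpos : ∀ x i, ((U x)ᴴ * F x i * U x).PosSemidef := fun x i =>
    (hF x i).conjTranspose_mul_mul_same _
  have hUs : ∀ x, (U x)ᴴ * U x = 1 := fun x => Matrix.mem_unitaryGroup_iff'.mp (hU x)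
  set g : X → Fin (n + 1) → (Fin (n + 1) → ℂ) → ENNReal := fun x i =>
    ((fun z => (U x)ᴴ *ᵥ z) ⁻¹' dominantSet i).indicator
      fun z => ENNReal.ofReal (star z ⬝ᵥ F x i *ᵥ z).re with hg
  have hgm : ∀ x i, Measurable (g x i) := fun x i =>
    (measurable_quadForm _).indicator <|
      (show Continuous fun z => (U x)ᴴ *ᵥ z by fun_prop).measurable (measurableSet_dominantSet i)
  have hg1 : ∀ x i z, (U x)ᴴ *ᵥ z ∈ dominantSet i →
      g x i z = ENNReal.ofReal (star z ⬝ᵥ F x i *ᵥ z).re := fun x i z h =>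
    Set.indicator_of_mem (s := (fun z => (U x)ᴴ *ᵥ z) ⁻¹' dominantSet i) h _
  have hg0 : ∀ x i z, (U x)ᴴ *ᵥ z ∉ dominantSet i → g x i z = 0 := fun x i z h =>
    Set.indicator_of_notMem (s := (fun z => (U x)ᴴ *ᵥ z) ⁻¹' dominantSet i) h _
  have hpt : ∀ z, ∑ x, ∑ i, g x i z ≤ ENNReal.ofReal W * ∑ i, ENNReal.ofReal (‖z i‖ ^ 2) := by
    intro z
    -- At most one coordinate dominates strictly. In case of a tie every `g x i z` vanishes, so the
    -- default index 0 is harmless.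
    have hex : ∀ x, ∃ k, ∀ i, (U x)ᴴ *ᵥ z ∈ dominantSet i → i = k := fun x => by
      by_cases h : ∃ k, (U x)ᴴ *ᵥ z ∈ dominantSet k
      · exact ⟨h.choose, fun i hi => eq_of_mem_dominantSet hi h.choose_spec⟩
      · exact ⟨0, fun i hi => (h ⟨i, hi⟩).elim⟩
    choose f hf using hex
    calc ∑ x, ∑ i, g x i z ≤ ∑ x, ENNReal.ofReal (star z ⬝ᵥ F x (f x) *ᵥ z).re := by
          refine Finset.sum_le_sum fun x _ => ?_
          rw [Finset.sum_eq_single (f x)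
            (fun i _ hi => hg0 x i z fun h => hi (hf x i h))
            (fun h => (h (Finset.mem_univ _)).elim)]
          exact Set.indicator_le_self _ _ z
      _ = ENNReal.ofReal (∑ x, (star z ⬝ᵥ F x (f x) *ᵥ z).re) :=
          (ENNReal.ofReal_sum_of_nonneg fun x _ => hq _ _ _).symm
      _ ≤ ENNReal.ofReal (W * ∑ i, ‖z i‖ ^ 2) := ENNReal.ofReal_le_ofReal (hW f z)
      _ = _ := by
          rw [ENNReal.ofReal_mul hW0, ENNReal.ofReal_sum_of_nonneg fun i _ => sq_nonneg _]
  have hterm : ∀ x i, ENNReal.ofReal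
      ((((U x)ᴴ * F x i * U x) i i).re * (harmonic (n + 1) / (n + 1)))
      ≤ ∫⁻ z, g x i z ∂complexGaussianPi (n + 1) := fun x i => by
    -- Substituting `U x *ᵥ z` for `z` turns dominance in the basis `U x` into dominance in the
    -- standard basis.
    rw [← lintegral_complexGaussianPi_unitary (hU x) (hgm x i)]
    refine (diag_mul_le_lintegral_dominantSet (hpos x i) i).trans_eq ?_
    rw [← lintegral_indicator (measurableSet_dominantSet i)]
    refine lintegral_congr fun z => ?_
    have hz : (U x)ᴴ *ᵥ (U x *ᵥ z) = z := by
      rw [Matrix.mulVec_mulVec, hUs, Matrix.one_mulVec]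
    have hQ : star z ⬝ᵥ ((U x)ᴴ * F x i * U x) *ᵥ z
        = star (U x *ᵥ z) ⬝ᵥ F x i *ᵥ (U x *ᵥ z) := by
      rw [Matrix.star_mulVec, ← Matrix.mulVec_mulVec, ← Matrix.mulVec_mulVec,
        Matrix.dotProduct_mulVec]
    by_cases h : z ∈ dominantSet i
    · rw [Set.indicator_of_mem h, hg1 x i _ (by rwa [hz]), hQ]
    · rw [Set.indicator_of_notMem h, hg0 x i _ (by rwa [hz])]
  have hH : (0 : ℝ) ≤ harmonic (n + 1) / (n + 1) := by
    have : (0 : ℚ) ≤ harmonic (n + 1) := (harmonic_pos n.succ_ne_zero).le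
    have : (0 : ℝ) ≤ harmonic (n + 1) := by exact_mod_cast this
    positivity
  rw [← ENNReal.ofReal_le_ofReal_iff (by positivity)]
  calc ENNReal.ofReal ((∑ x, ∑ i, (((U x)ᴴ * F x i * U x) i i).re)
        * (harmonic (n + 1) / (n + 1)))
      = ∑ x, ∑ i, ENNReal.ofReal
        ((((U x)ᴴ * F x i * U x) i i).re * (harmonic (n + 1) / (n + 1))) := by
        have h0 : ∀ x i, 0 ≤ (((U x)ᴴ * F x i * U x) i i).re * (harmonic (n + 1) / (n + 1) : ℝ) :=
          fun x i => mul_nonneg (Complex.le_def.mp (hpos x i).diag_nonneg).1 hH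
        rw [Finset.sum_mul, ENNReal.ofReal_sum_of_nonneg fun x _ => by
          rw [Finset.sum_mul]; exact Finset.sum_nonneg fun i _ => h0 x i]
        refine Finset.sum_congr rfl fun x _ => ?_
        rw [Finset.sum_mul, ENNReal.ofReal_sum_of_nonneg fun i _ => h0 x i]
    _ ≤ ∑ x, ∑ i, ∫⁻ z, g x i z ∂complexGaussianPi (n + 1) :=
        Finset.sum_le_sum fun x _ => Finset.sum_le_sum fun i _ => hterm x i
    _ = ∫⁻ z, ∑ x, ∑ i, g x i z ∂complexGaussianPi (n + 1) := by
        rw [lintegral_finsetSum _ fun x _ => Finset.measurable_sum _ fun i _ => hgm x i]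
        exact Finset.sum_congr rfl fun x _ => (lintegral_finsetSum _ fun i _ => hgm x i).symm
    _ ≤ ∫⁻ z, ENNReal.ofReal W * ∑ i, ENNReal.ofReal (‖z i‖ ^ 2) ∂complexGaussianPi (n + 1) :=
        lintegral_mono hpt
    _ = ENNReal.ofReal (W * (n + 1)) := by
        rw [lintegral_const_mul _ (by fun_prop), lintegral_finsetSum _ fun i _ => by fun_prop]
        simp only [lintegral_complexGaussianPi_norm_sq, ENNReal.ofReal_mul hW0]
        congr 1
        simp [ENNReal.ofReal_add]

/-! ### Diagonalising projective measurements -/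

/-- Projective measurements are diagonal in an orthonormal basis. -/
lemma IsProjectiveMeasurement.exists_unitary {n A : Type*} [Fintype n] [DecidableEq n] [Fintype A]
    {E : A → Matrix n n ℂ} (hE : IsProjectiveMeasurement E) :
    ∃ U ∈ Matrix.unitaryGroup n ℂ, ∃ c : n → A, ∀ F : A → Matrix n n ℂ,
      ∑ a, (F a * E a).trace = ∑ i, (Uᴴ * F (c i) * U) i i := by
  classical
  -- Distinct real labels make `∑ a, k a • E a` a Hermitian matrix whose eigenvectors each lie in
  -- the range of a single `E a`; `c` records which one. Projections of higher rank give repeated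
  -- values of `c`.
  set k : A → ℂ := fun a => ((Fintype.equivFin A a : ℕ) : ℂ) with hk
  have hkinj : Function.Injective k := fun a b h => by
    simpa [hk, Fin.val_inj] using h
  have hD : (∑ a, k a • E a).IsHermitian := by
    rw [Matrix.IsHermitian, Matrix.conjTranspose_sum]
    refine Finset.sum_congr rfl fun a _ => ?_
    rw [Matrix.conjTranspose_smul, ← Matrix.star_eq_conjTranspose,
      (hE.proj a).isSelfAdjoint.star_eq]
    simp [hk]
  set φ : n → n → ℂ := fun i => ⇑(hD.eigenvectorBasis i) with hφ
  have hφ0 : ∀ i, φ i ≠ 0 := fun i h =>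
    hD.eigenvectorBasis.toBasis.ne_zero i (by ext j; simpa [hφ] using congrFun h j)
  have hev : ∀ i b, k b • (E b *ᵥ φ i) = (hD.eigenvalues i : ℂ) • (E b *ᵥ φ i) := fun i b => by
    have h := congrArg (E b *ᵥ ·) (hD.mulVec_eigenvectorBasis i)
    have hb : E b * ∑ a, k a • E a = k b • E b := by
      rw [Finset.mul_sum, Finset.sum_eq_single b]
      · rw [Matrix.mul_smul, (hE.proj b).isIdempotentElem.eq]
      · intro a _ hab
        rw [Matrix.mul_smul, hE.orthogonal b a hab.symm, smul_zero]
      · simp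
    simp only [Matrix.mulVec_mulVec, hb, Matrix.smul_mulVec] at h
    rw [h, ← Matrix.mulVec_smul]
    rfl
  have hsum : ∀ i, ∑ a, E a *ᵥ φ i = φ i := fun i => by
    rw [← Matrix.sum_mulVec, hE.sum_eq_one, Matrix.one_mulVec]
  have hne : ∀ i, ∃ a, E a *ᵥ φ i ≠ 0 := fun i => by
    by_contra! h
    exact hφ0 i (by rw [← hsum i, Finset.sum_eq_zero fun a _ => h a])
  choose c hc using hne
  have hkc : ∀ i b, E b *ᵥ φ i ≠ 0 → k b = hD.eigenvalues i := fun i b hb =>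
    smul_left_injective ℂ hb (hev i b)
  have hzero : ∀ i b, b ≠ c i → E b *ᵥ φ i = 0 := fun i b hb => by
    by_contra h
    exact hb (hkinj ((hkc i b h).trans (hkc i _ (hc i)).symm))
  have hone : ∀ i, E (c i) *ᵥ φ i = φ i := fun i => by
    nth_rewrite 2 [← hsum i]
    exact (Finset.sum_eq_single (c i) (fun b _ hb => hzero i b hb) (by simp)).symm
  refine ⟨hD.eigenvectorUnitary.1, hD.eigenvectorUnitary.2, c, fun F => ?_⟩
  set U : Matrix n n ℂ := hD.eigenvectorUnitary.1 with hUdef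
  have hUU : U * Uᴴ = 1 := Matrix.mem_unitaryGroup_iff.mp hD.eigenvectorUnitary.2
  have hcol : ∀ (M : Matrix n n ℂ) i, (M * U) *ᵥ Pi.single i 1 = M *ᵥ φ i := fun M i => by
    rw [← Matrix.mulVec_mulVec, hUdef, hD.eigenvectorUnitary_mulVec]
  have hdiag : ∀ (M : Matrix n n ℂ) i, (M * U) i i = (M *ᵥ φ i) i := fun M i => by
    rw [← hcol]
    simp
  have htr : ∀ a, (F a * E a).trace = ∑ i, (Uᴴ * F a * E a * U) i i := fun a => by
    have : (Uᴴ * F a * E a * U).trace = (F a * E a).trace := by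
      rw [Matrix.trace_mul_comm, ← mul_assoc, ← mul_assoc, hUU, one_mul]
    rw [← this]
    rfl
  simp_rw [htr]
  rw [Finset.sum_comm]
  refine Finset.sum_congr rfl fun i _ => ?_
  rw [Finset.sum_eq_single (c i)]
  · rw [hdiag, hdiag, ← Matrix.mulVec_mulVec, hone]
  · intro b _ hb
    rw [hdiag, ← Matrix.mulVec_mulVec, hzero i b hb]
    simp
  · simp

/-- If deterministic strategies reach at most `W`, then projective measurements on the maximally
entangled state reach at most `W d / H_d`. -/
theorem sum_trace_mul_projective_le {n : ℕ} {X A : Type*} [Fintype X] [Fintype A]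
    {F : X → A → Matrix (Fin (n + 1)) (Fin (n + 1)) ℂ} (hF : ∀ x a, (F x a).PosSemidef)
    {E : X → A → Matrix (Fin (n + 1)) (Fin (n + 1)) ℂ} (hE : ∀ x, IsProjectiveMeasurement (E x))
    {W : ℝ} (hW0 : 0 ≤ W)
    (hW : ∀ (c : X → A) (z : Fin (n + 1) → ℂ),
      ∑ x, (star z ⬝ᵥ F x (c x) *ᵥ z).re ≤ W * ∑ i, ‖z i‖ ^ 2) :
    (∑ x, ∑ a, (F x a * E x a).trace.re) * (harmonic (n + 1) / (n + 1)) ≤ W * (n + 1) := by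
  choose U hU c hc using fun x => (hE x).exists_unitary
  have := sum_quadForm_col_mul_le (F := fun x i => F x (c x i)) (fun x i => hF x _) hU hW0
    fun f z => hW (fun x => c x (f x)) z
  convert this using 3 with x
  rw [← Complex.re_sum, hc x (F x), Complex.re_sum]

/-! ### Reduction of the maximally entangled state to traces -/

section MaximallyEntangled

variable {d : ℕ}

lemma maxEntangled_apply (i j k l : Fin d) :
    maxEntangled d (i, j) (k, l) = if i = j ∧ k = l then (d : ℂ)⁻¹ else 0 := by
  have h : (((Real.sqrt d)⁻¹ : ℝ) : ℂ) * (((Real.sqrt d)⁻¹ : ℝ) : ℂ) = (d : ℂ)⁻¹ := by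
    rw [← Complex.ofReal_mul, ← mul_inv, Real.mul_self_sqrt (Nat.cast_nonneg d)]
    simp
  by_cases h1 : i = j <;> by_cases h2 : k = l <;>
    simp [maxEntangled, maxEntangledVec, Matrix.vecMulVec_apply, h1, h2]
  simpa using h

lemma assemblage_maxEntangled {X A : Type*} (E : X → A → Matrix (Fin d) (Fin d) ℂ) (x : X)
    (a : A) : assemblage (maxEntangled d) E x a = (d : ℂ)⁻¹ • (E x a)ᵀ := by
  ext j k
  simp [assemblage, partialTraceA, Matrix.mul_apply, Fintype.sum_prod_type, maxEntangled_apply,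
    Matrix.kroneckerMap_apply, Matrix.one_apply, ite_and]

lemma trace_maxEntangled_mul_kronecker (M N : Matrix (Fin d) (Fin d) ℂ) :
    (maxEntangled d * (M ⊗ₖ N)).trace = (d : ℂ)⁻¹ * (N * Mᵀ).trace := by
  simp only [Matrix.trace, Matrix.diag, Matrix.mul_apply, Fintype.sum_prod_type,
    maxEntangled_apply, Matrix.kroneckerMap_apply, ite_and, ite_mul, zero_mul,
    Matrix.transpose_apply, Finset.mul_sum]
  simp only [Finset.sum_ite_irrel, Finset.sum_const_zero, Finset.sum_ite_eq, Finset.mem_univ,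
    if_true]
  rw [Finset.sum_comm]
  exact Finset.sum_congr rfl fun i _ => Finset.sum_congr rfl fun k _ => by ring

/-- Needed because the maximally entangled state hands Bob the transposes of Alice's projections. -/
lemma IsProjectiveMeasurement.transpose {n A : Type*} [Fintype n] [DecidableEq n] [Fintype A]
    {E : A → Matrix n n ℂ} (hE : IsProjectiveMeasurement E) :
    IsProjectiveMeasurement fun a => (E a)ᵀ where
  proj a := by
    refine ⟨?_, ?_⟩
    · rw [IsIdempotentElem, ← Matrix.transpose_mul, (hE.proj a).isIdempotentElem.eq]
    · have h : (E a)ᴴ = E a := (hE.proj a).isSelfAdjoint.star_eq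
      rw [isSelfAdjoint_iff, Matrix.star_eq_conjTranspose]
      change ((E a)ᴴ)ᵀ = _
      rw [h]
  orthogonal a b h := by
    rw [← Matrix.transpose_mul, hE.orthogonal b a h.symm, Matrix.transpose_zero]
  sum_eq_one := by rw [← Matrix.transpose_sum, hE.sum_eq_one, Matrix.transpose_one]

lemma IsProjectiveMeasurement.posSemidef {n A : Type*} [Fintype n] [DecidableEq n] [Fintype A]
    {E : A → Matrix n n ℂ} (hE : IsProjectiveMeasurement E) (a : A) : (E a).PosSemidef := by
  have h := Matrix.posSemidef_conjTranspose_mul_self (E a)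
  rwa [← Matrix.star_eq_conjTranspose, (hE.proj a).isSelfAdjoint.star_eq,
    (hE.proj a).isIdempotentElem.eq] at h

lemma steeringValue_assemblage_maxEntangled {X A : Type*} [Fintype X] [Fintype A]
    (F E : X → A → Matrix (Fin d) (Fin d) ℂ) :
    steeringValue F (assemblage (maxEntangled d) E)
      = (d : ℝ)⁻¹ * ∑ x, ∑ a, (F x a * (E x a)ᵀ).trace.re := by
  simp only [steeringValue, assemblage_maxEntangled, Matrix.mul_smul, Matrix.trace_smul,
    smul_eq_mul, Finset.mul_sum]
  refine Finset.sum_congr rfl fun x _ => Finset.sum_congr rfl fun a _ => ?_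
  rw [← Complex.re_ofReal_mul]
  simp

end MaximallyEntangled

/-! ### The bound, its asymptotics, and the common estimate -/

section Bound

lemma one_le_harmonic {d : ℕ} (hd : 1 ≤ d) : (1 : ℝ) ≤ harmonic d := by
  have : ∀ n : ℕ, (1 : ℚ) ≤ harmonic (n + 1) := fun n => by
    induction n with
    | zero => simp
    | succ n ih =>
      rw [harmonic_succ]
      have : (0 : ℚ) ≤ ((n + 1 + 1 : ℕ) : ℚ)⁻¹ := by positivity
      linarith
  obtain ⟨n, rfl⟩ := Nat.exists_eq_add_of_le' hd
  exact_mod_cast this n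

lemma harmonic_le_self (d : ℕ) : (harmonic d : ℝ) ≤ d := by
  have : harmonic d ≤ (d : ℚ) := by
    induction d with
    | zero => simp
    | succ n ih =>
      rw [harmonic_succ]
      have : ((n + 1 : ℕ) : ℚ)⁻¹ ≤ 1 := inv_le_one_of_one_le₀ (by simp)
      push_cast at this ⊢
      linarith
  exact_mod_cast this

lemma violationBound_denom_pos {d : ℕ} (hd : 1 ≤ d) :
    (0 : ℝ) < (harmonic d : ℝ) + (harmonic d : ℝ) * d - d := by
  have h := one_le_harmonic hd
  have h' : (0 : ℝ) ≤ d := Nat.cast_nonneg d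
  nlinarith

lemma violationBound_nonneg {d : ℕ} (hd : 1 ≤ d) : 0 ≤ violationBound d :=
  div_nonneg (sq_nonneg _) (violationBound_denom_pos hd).le

/-- After cross-multiplication this is `H_d ≤ d`. -/
lemma div_harmonic_le_violationBound {d : ℕ} (hd : 1 ≤ d) :
    (d : ℝ) / harmonic d ≤ violationBound d := by
  have h := one_le_harmonic hd
  have h' : (0 : ℝ) ≤ d := Nat.cast_nonneg d
  rw [violationBound, div_le_div_iff₀ (by linarith) (violationBound_denom_pos hd)]
  nlinarith [harmonic_le_self d]

/-- `H_d - log d` converges to the Euler–Mascheroni constant, while `log d` diverges. -/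
lemma tendsto_harmonic_div_log :
    Filter.Tendsto (fun d : ℕ => (harmonic d : ℝ) / Real.log d) Filter.atTop (nhds 1) := by
  have hlog : Filter.Tendsto (fun d : ℕ => Real.log d) Filter.atTop Filter.atTop :=
    Real.tendsto_log_atTop.comp tendsto_natCast_atTop_atTop
  have h := (Real.tendsto_harmonic_sub_log.div_atTop hlog).add_const 1
  rw [zero_add] at h
  refine h.congr' ?_
  filter_upwards [hlog.eventually_gt_atTop 0] with d hd
  field_simp
  ring

theorem isEquivalent_violationBound :
    Asymptotics.IsEquivalent Filter.atTop violationBound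
      (fun d : ℕ => (d : ℝ) / Real.log d) := by
  have hlog : Filter.Tendsto (fun d : ℕ => Real.log d) Filter.atTop Filter.atTop :=
    Real.tendsto_log_atTop.comp tendsto_natCast_atTop_atTop
  have hinv : Filter.Tendsto (fun d : ℕ => (d : ℝ)⁻¹) Filter.atTop (nhds 0) :=
    tendsto_inv_atTop_nhds_zero_nat
  refine Asymptotics.isEquivalent_of_tendsto_one ?_
  -- The ratio to `d / log d` is the inverse of `(H_d / log d)(1 + 1/d) - 1/log d`, which tends to
  -- 1.
  have h := ((tendsto_harmonic_div_log.mul (hinv.const_add 1)).sub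
    (tendsto_inv_atTop_zero.comp hlog)).inv₀ (by norm_num)
  norm_num at h
  refine h.congr' ?_
  filter_upwards [hlog.eventually_gt_atTop 0, Filter.eventually_ge_atTop 1] with d hd hd1
  have hd0 : (0 : ℝ) < d := by exact_mod_cast hd1
  have hden := violationBound_denom_pos hd1
  have hne : (harmonic d : ℝ) * (d + 1) - d ≠ 0 := by
    intro h0
    linarith
  simp only [Pi.div_apply, violationBound]
  rw [show (harmonic d : ℝ) / Real.log d * (1 + (d : ℝ)⁻¹) - (Real.log d)⁻¹
    = ((harmonic d : ℝ) * (d + 1) - d) / (d * Real.log d) by field_simp,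
    show (harmonic d : ℝ) + (harmonic d : ℝ) * d - d = (harmonic d : ℝ) * (d + 1) - d by ring]
  field_simp

/-- If deterministic strategies on unit vectors reach at most `W`, then projective measurements on
the maximally entangled state reach at most `W` times `violationBound d`. -/
theorem projective_value_le {d : ℕ} (hd : 1 ≤ d) {X A : Type*} [Fintype X] [Fintype A]
    {F : X → A → Matrix (Fin d) (Fin d) ℂ} (hF : ∀ x a, (F x a).PosSemidef)
    {E : X → A → Matrix (Fin d) (Fin d) ℂ} (hE : ∀ x, IsProjectiveMeasurement (E x))
    {W : ℝ} (hW0 : 0 ≤ W)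
    (hW : ∀ (c : X → A) (z : Fin d → ℂ), star z ⬝ᵥ z = 1 →
      ∑ x, (star z ⬝ᵥ F x (c x) *ᵥ z).re ≤ W) :
    (d : ℝ)⁻¹ * ∑ x, ∑ a, (F x a * (E x a)ᵀ).trace.re ≤ violationBound d * W := by
  have hW' : ∀ (c : X → A) (z : Fin d → ℂ),
      ∑ x, (star z ⬝ᵥ F x (c x) *ᵥ z).re ≤ W * ∑ i, ‖z i‖ ^ 2 := fun c z => by
    rcases eq_or_ne z 0 with rfl | hz
    · simp
    have hs : 0 < ∑ i, ‖z i‖ ^ 2 := by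
      obtain ⟨i, hi⟩ := Function.ne_iff.mp hz
      exact Finset.sum_pos' (fun j _ => sq_nonneg _)
        ⟨i, Finset.mem_univ i, pow_pos (norm_pos_iff.mpr hi) 2⟩
    have hzz : star z ⬝ᵥ z = ((∑ i, ‖z i‖ ^ 2 : ℝ) : ℂ) := by
      simp [dotProduct, Complex.ofReal_sum, Complex.conj_mul']
    set s := ∑ i, ‖z i‖ ^ 2
    -- Both sides are homogeneous of degree two, so the bound on unit vectors extends by normalising
    -- `z`.
    obtain ⟨t, ht⟩ : ∃ t : ℝ, t * t = s⁻¹ :=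
      ⟨√s⁻¹, Real.mul_self_sqrt (inv_nonneg.mpr hs.le)⟩
    have hscale : ∀ w : Fin d → ℂ, star ((t : ℂ) • z) ⬝ᵥ ((t : ℂ) • w) = (s⁻¹ : ℝ) * (star z ⬝ᵥ w) :=
      fun w => by
        rw [star_smul, smul_dotProduct, dotProduct_smul, ← ht]
        simp [mul_assoc]
    have h := hW c ((t : ℂ) • z) (by
      rw [hscale, hzz, ← Complex.ofReal_mul, inv_mul_cancel₀ hs.ne', Complex.ofReal_one])
    simp_rw [Matrix.mulVec_smul, hscale, Complex.re_ofReal_mul] at h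
    rw [← Finset.mul_sum, inv_mul_le_iff₀ hs] at h
    linarith
  obtain ⟨n, rfl⟩ := Nat.exists_eq_add_of_le' hd
  have key := sum_trace_mul_projective_le hF (fun x => (hE x).transpose) hW0 hW'
  have hH := one_le_harmonic hd
  refine le_trans ?_ (mul_le_mul_of_nonneg_right (div_harmonic_le_violationBound hd) hW0)
  have hn : (0 : ℝ) < (n : ℝ) + 1 := by positivity
  have hH0 : (0 : ℝ) < harmonic (n + 1) := by linarith
  push_cast
  rw [mul_div_assoc', div_le_iff₀ hn] at key
  rw [inv_mul_le_iff₀ hn, mul_comm_div, mul_div_assoc', mul_div_assoc', le_div_iff₀ hH0]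
  linarith

end Bound

/-! ### Steering inequalities -/

section Steering

variable {n X A : Type*} [Fintype n] [Fintype A]

lemma IsDistribution.le_one {p : A → ℝ} (hp : IsDistribution p) (a : A) : p a ≤ 1 :=
  hp.2 ▸ Finset.single_le_sum (fun b _ => hp.1 b) (Finset.mem_univ a)

open scoped MatrixOrder Matrix.Norms.L2Operator in
lemma exists_eq_conjTranspose_mul_self [DecidableEq n] {M : Matrix n n ℂ} (hM : M.PosSemidef) :
    ∃ B : Matrix n n ℂ, M = Bᴴ * B :=
  CStarAlgebra.nonneg_iff_eq_star_mul_self.mp hM.nonneg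

/-- Write `s = Bᴴ * B`; the inequality `2|ab| ≤ |a|² + |b|²` bounds an entry by the mean of two
diagonal entries, each at most the trace. This makes the set of classical values bounded. -/
lemma IsDensityMatrix.norm_apply_le_one {s : Matrix n n ℂ} (hs : IsDensityMatrix s) (i j : n) :
    ‖s i j‖ ≤ 1 := by
  classical
  have hd : ∀ i, (s i i).re ≤ 1 := fun i => by
    have h1 : ∑ i, (s i i).re = 1 := by
      rw [← Complex.re_sum]
      exact congrArg Complex.re hs.2
    exact h1 ▸ Finset.single_le_sum (f := fun i => (s i i).re)
      (fun k _ => (Complex.le_def.mp hs.1.diag_nonneg).1) (Finset.mem_univ i)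
  obtain ⟨B, hB⟩ := exists_eq_conjTranspose_mul_self hs.1
  have hdiag : ∀ i, (s i i).re = ∑ k, ‖B k i‖ ^ 2 := fun i => by
    rw [hB, Matrix.mul_apply, Complex.re_sum]
    refine Finset.sum_congr rfl fun k _ => ?_
    rw [Matrix.conjTranspose_apply, Complex.star_def, Complex.conj_mul', ← Complex.ofReal_pow,
      Complex.ofReal_re]
  have hle : ‖s i j‖ ≤ ∑ k, (‖B k i‖ ^ 2 + ‖B k j‖ ^ 2) / 2 := by
    rw [hB, Matrix.mul_apply]
    refine (norm_sum_le _ _).trans (Finset.sum_le_sum fun k _ => ?_)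
    rw [norm_mul, Matrix.conjTranspose_apply, norm_star]
    nlinarith [sq_nonneg (‖B k i‖ - ‖B k j‖)]
  rw [← Finset.sum_div, Finset.sum_add_distrib, ← hdiag, ← hdiag] at hle
  linarith [hd i, hd j]

lemma IsLHS.norm_apply_le_one {σ : X → A → Matrix n n ℂ} (hσ : IsLHS σ) (x : X) (a : A)
    (i j : n) : ‖σ x a i j‖ ≤ 1 := by
  obtain ⟨L, _, μ, p, s, _, -, hp, -, hs, h⟩ := hσ
  rw [h]
  refine (norm_integral_le_of_norm_le_const (C := 1) (ae_of_all _ fun l => ?_)).trans (by simp)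
  rw [norm_mul, Complex.norm_real, Real.norm_of_nonneg ((hp l x).1 a)]
  exact mul_le_one₀ ((hp l x).le_one a) (norm_nonneg _) ((hs l).norm_apply_le_one i j)

variable [Fintype X]

theorem bddAbove_lhsValues (F : X → A → Matrix n n ℂ) : BddAbove (lhsValues F) := by
  refine ⟨∑ x, ∑ a, ∑ i, ∑ j, ‖F x a i j‖, ?_⟩
  rintro _ ⟨σ, hσ, rfl⟩
  refine Finset.sum_le_sum fun x _ => Finset.sum_le_sum fun a _ => ?_
  rw [Matrix.trace, Complex.re_sum]
  refine Finset.sum_le_sum fun i _ => ?_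
  rw [Matrix.diag_apply, Matrix.mul_apply, Complex.re_sum]
  refine Finset.sum_le_sum fun j _ => (Complex.re_le_norm _).trans ?_
  rw [norm_mul]
  exact mul_le_of_le_one_right (norm_nonneg _) (hσ.norm_apply_le_one x a j i)

lemma isDistribution_single [DecidableEq A] (c : A) :
    IsDistribution fun a => if a = c then (1 : ℝ) else 0 :=
  ⟨fun a => by dsimp only; split_ifs <;> simp, by simp⟩

/-- Deterministic responses to a fixed pure hidden state. -/
lemma sum_quadForm_mem_lhsValues (F : X → A → Matrix n n ℂ) (c : X → A) {z : n → ℂ}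
    (hz : star z ⬝ᵥ z = 1) : ∑ x, (star z ⬝ᵥ F x (c x) *ᵥ z).re ∈ lhsValues F := by
  classical
  refine ⟨fun x a => ((if a = c x then (1 : ℝ) else 0 : ℝ) : ℂ) • Matrix.vecMulVec z (star z),
    ⟨Unit, inferInstance, Measure.dirac (), fun _ x a => if a = c x then 1 else 0,
      fun _ => Matrix.vecMulVec z (star z), inferInstance, fun _ _ => measurable_const,
      fun _ x => isDistribution_single (c x), fun _ _ => measurable_const, fun _ =>
      ⟨Matrix.posSemidef_vecMulVec_self_star z, ?_⟩, fun x a i j => ?_⟩, ?_⟩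
  · rw [Matrix.trace_vecMulVec, dotProduct_comm, hz]
  · rw [integral_dirac]
    rfl
  · refine Finset.sum_congr rfl fun x _ => ?_
    rw [Finset.sum_eq_single (c x)]
    · dsimp only
      rw [if_pos rfl, Complex.ofReal_one, one_smul, Matrix.mul_vecMulVec, Matrix.trace_vecMulVec,
        dotProduct_comm]
    · intro a _ ha
      simp [ha]
    · simp

lemma sum_quadForm_le_steeringBound (F : X → A → Matrix n n ℂ) (c : X → A) {z : n → ℂ}
    (hz : star z ⬝ᵥ z = 1) : ∑ x, (star z ⬝ᵥ F x (c x) *ᵥ z).re ≤ steeringBound F :=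
  le_csSup (bddAbove_lhsValues F) (sum_quadForm_mem_lhsValues F c hz)

/-- A nonzero positive semidefinite matrix has nonzero trace, hence a positive diagonal entry `i`;
the hidden state `e_i` with constant answer `a` detects it. -/
theorem steeringBound_pos [DecidableEq n] {F : X → A → Matrix n n ℂ}
    (hF : ∀ x a, (F x a).PosSemidef) (h : ∃ x a, F x a ≠ 0) : 0 < steeringBound F := by
  obtain ⟨x, a, hxa⟩ := h
  obtain ⟨i, hi⟩ : ∃ i, F x a i i ≠ 0 := by
    by_contra! h0
    exact hxa ((hF x a).trace_eq_zero_iff.mp (Finset.sum_eq_zero fun i _ => h0 i))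
  have hq : ∀ y, star (Pi.single i (1 : ℂ)) ⬝ᵥ F y a *ᵥ Pi.single i 1 = F y a i i := fun y => by
    simp
  refine lt_of_lt_of_le ?_ (sum_quadForm_le_steeringBound F (fun _ => a)
    (z := Pi.single i 1) (by simp))
  simp_rw [hq]
  refine Finset.sum_pos' (fun y _ => (Complex.le_def.mp (hF y a).diag_nonneg).1)
    ⟨x, Finset.mem_univ x, ?_⟩
  exact (Complex.lt_def.mp (lt_of_le_of_ne (hF x a).diag_nonneg hi.symm)).1

theorem steeringFraction_le_violationBound {d : ℕ} (hd : 1 ≤ d)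
    {F : X → A → Matrix (Fin d) (Fin d) ℂ} (hF : ∀ x a, (F x a).PosSemidef) {r : ℝ}
    (hr : r ∈ projSteeringFractions (maxEntangled d) F) : r ≤ violationBound d := by
  obtain ⟨E, hE, rfl⟩ := hr
  rw [steeringFraction, steeringValue_assemblage_maxEntangled]
  by_cases h : ∃ x a, F x a ≠ 0
  · have hpos := steeringBound_pos hF h
    rw [one_div, inv_mul_le_iff₀ hpos, mul_comm (steeringBound F)]
    exact projective_value_le hd hF hE hpos.le
      fun c z hz => sum_quadForm_le_steeringBound F c hz
  · push Not at h
    simpa [h] using violationBound_nonneg hd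

end Steering

/-! ### Bell inequalities -/

section Bell

variable {X Y A B : Type*} [Fintype Y] [Fintype B]

/-- The steering functional which a Bell functional and Bob's measurements induce. -/
def inducedSteering {n : Type*} (β : X → Y → A → B → ℝ) (EB : Y → B → Matrix n n ℂ) :
    X → A → Matrix n n ℂ :=
  fun x a => ∑ y, ∑ b, (β x y a b : ℂ) • EB y b

lemma inducedSteering_posSemidef {n : Type*} [Fintype n] [DecidableEq n]
    {β : X → Y → A → B → ℝ} (hβ : ∀ x y a b, 0 ≤ β x y a b) {EB : Y → B → Matrix n n ℂ}
    (hEB : ∀ y, IsProjectiveMeasurement (EB y)) (x : X) (a : A) :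
    (inducedSteering β EB x a).PosSemidef :=
  Matrix.posSemidef_sum _ fun y _ => Matrix.posSemidef_sum _ fun b _ =>
    ((hEB y).posSemidef b).smul (by exact_mod_cast hβ x y a b)

lemma quadForm_inducedSteering {n : Type*} [Fintype n] (β : X → Y → A → B → ℝ)
    (EB : Y → B → Matrix n n ℂ) (x : X) (a : A) (z : n → ℂ) :
    (star z ⬝ᵥ inducedSteering β EB x a *ᵥ z).re
      = ∑ y, ∑ b, β x y a b * (star z ⬝ᵥ EB y b *ᵥ z).re := by
  simp only [inducedSteering, Matrix.sum_mulVec, dotProduct_sum, Complex.re_sum,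
    Matrix.smul_mulVec, dotProduct_smul, smul_eq_mul, Complex.re_ofReal_mul]

variable [Fintype X] [Fintype A]

theorem bddAbove_lhvValues (β : X → Y → A → B → ℝ) : BddAbove (lhvValues β) := by
  refine ⟨∑ x, ∑ y, ∑ a, ∑ b, |β x y a b|, ?_⟩
  rintro _ ⟨P, ⟨L, _, μ, p, q, _, -, hp, -, hq, h⟩, rfl⟩
  refine Finset.sum_le_sum fun x _ => Finset.sum_le_sum fun y _ => Finset.sum_le_sum fun a _ =>
    Finset.sum_le_sum fun b _ => (le_abs_self _).trans ?_
  rw [abs_mul]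
  refine mul_le_of_le_one_right (abs_nonneg _) ?_
  rw [h, ← Real.norm_eq_abs]
  refine (norm_integral_le_of_norm_le_const (C := 1) (ae_of_all _ fun l => ?_)).trans (by simp)
  rw [norm_mul, Real.norm_of_nonneg ((hp l x).1 a), Real.norm_of_nonneg ((hq l y).1 b)]
  exact mul_le_one₀ ((hp l x).le_one a) ((hq l y).1 b) ((hq l y).le_one b)

/-- Deterministic responses of Alice, combined with local randomness of Bob. -/
lemma sum_mul_le_localBound (β : X → Y → A → B → ℝ) (c : X → A) {q : Y → B → ℝ}
    (hq : ∀ y, IsDistribution (q y)) :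
    ∑ x, ∑ y, ∑ b, β x y (c x) b * q y b ≤ localBound β := by
  classical
  refine le_csSup (bddAbove_lhvValues β)
    ⟨fun x y a b => (if a = c x then 1 else 0) * q y b,
    ⟨Unit, inferInstance, Measure.dirac (), fun _ x a => if a = c x then 1 else 0, fun _ => q,
      inferInstance, fun _ _ => measurable_const, fun _ x => isDistribution_single (c x),
      fun _ _ => measurable_const, fun _ => hq, fun x y a b => ?_⟩, ?_⟩
  · rw [integral_dirac]
  · refine Finset.sum_congr rfl fun x _ => Finset.sum_congr rfl fun y _ => ?_
    rw [Finset.sum_eq_single (c x)]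
    · simp
    · intro a _ ha
      simp [ha]
    · simp

theorem localBound_pos {β : X → Y → A → B → ℝ} (hβ : ∀ x y a b, 0 ≤ β x y a b)
    (h : ∃ x y a b, β x y a b ≠ 0) : 0 < localBound β := by
  classical
  obtain ⟨x, y, a, b, hne⟩ := h
  refine lt_of_lt_of_le ?_ (sum_mul_le_localBound β (fun _ => a)
    (q := fun _ b' => if b' = b then 1 else 0) fun _ => isDistribution_single b)
  simp only [mul_ite, mul_one, mul_zero, Finset.sum_ite_eq', Finset.mem_univ, if_true]
  exact Finset.sum_pos' (fun x' _ => Finset.sum_nonneg fun y' _ => hβ _ _ _ _)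
    ⟨x, Finset.mem_univ x, Finset.sum_pos' (fun y' _ => hβ _ _ _ _)
      ⟨y, Finset.mem_univ y, lt_of_le_of_ne (hβ _ _ _ _) hne.symm⟩⟩

/-- Born's rule for a pure state. -/
lemma IsProjectiveMeasurement.isDistribution {n : Type*} [Fintype n] [DecidableEq n]
    {E : A → Matrix n n ℂ} (hE : IsProjectiveMeasurement E) {z : n → ℂ} (hz : star z ⬝ᵥ z = 1) :
    IsDistribution fun a => (star z ⬝ᵥ E a *ᵥ z).re := by
  refine ⟨fun a => (Complex.le_def.mp ((hE.posSemidef a).dotProduct_mulVec_nonneg z)).1, ?_⟩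
  rw [← Complex.re_sum, ← dotProduct_sum, ← Matrix.sum_mulVec, hE.sum_eq_one, Matrix.one_mulVec,
    hz, Complex.one_re]

lemma bellValue_maxEntangled {d : ℕ} (β : X → Y → A → B → ℝ)
    (EA : X → A → Matrix (Fin d) (Fin d) ℂ) (EB : Y → B → Matrix (Fin d) (Fin d) ℂ) :
    bellValue β (quantumCorrelation (maxEntangled d) EA EB)
      = (d : ℝ)⁻¹ * ∑ x, ∑ a, (inducedSteering β EB x a * (EA x a)ᵀ).trace.re := by
  have hre : ∀ w : ℂ, ((d : ℂ)⁻¹ * w).re = (d : ℝ)⁻¹ * w.re := fun w => by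
    rw [← Complex.re_ofReal_mul]
    simp
  simp only [bellValue, quantumCorrelation, trace_maxEntangled_mul_kronecker, inducedSteering,
    Finset.sum_mul, Matrix.trace_sum, Matrix.smul_mul, Matrix.trace_smul, smul_eq_mul,
    Complex.re_sum, Complex.re_ofReal_mul, hre, Finset.mul_sum]
  refine Finset.sum_congr rfl fun x _ => ?_
  rw [Finset.sum_comm]
  exact Finset.sum_congr rfl fun a _ => Finset.sum_congr rfl fun y _ =>
    Finset.sum_congr rfl fun b _ => by ring

theorem nonlocalityFraction_le_violationBound {d : ℕ} (hd : 1 ≤ d) {β : X → Y → A → B → ℝ}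
    (hβ : ∀ x y a b, 0 ≤ β x y a b) {r : ℝ}
    (hr : r ∈ projNonlocalityFractions (maxEntangled d) β) : r ≤ violationBound d := by
  obtain ⟨EA, EB, hEA, hEB, rfl⟩ := hr
  rw [nonlocalityFraction]
  by_cases h : ∃ x y a b, β x y a b ≠ 0
  · have hpos := localBound_pos hβ h
    rw [bellValue_maxEntangled, one_div, inv_mul_le_iff₀ hpos, mul_comm (localBound β)]
    -- The constant is the local bound itself, not the steering bound of the induced functional:
    -- only pure hidden states with deterministic answers of Alice have to be controlled.
    refine projective_value_le hd (inducedSteering_posSemidef hβ hEB) hEA hpos.le fun c z hz => ?_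
    simp_rw [quadForm_inducedSteering]
    exact sum_mul_le_localBound β c fun y => (hEB y).isDistribution hz
  · push Not at h
    simpa [bellValue, h] using violationBound_nonneg hd

end Bell

end Steering

end

theorem theorem2 :
    -- steering inequalities
    (∀ (d : ℕ), 1 ≤ d → ∀ (X A : Type*) [Fintype X] [Fintype A]
      (F : X → A → Matrix (Fin d) (Fin d) ℂ), (∀ x a, (F x a).PosSemidef) →
        BddAbove (Steering.lhsValues F) ∧
        ((∃ x a, F x a ≠ 0) → 0 < Steering.steeringBound F) ∧
        BddAbove (Steering.projSteeringFractions (Steering.maxEntangled d) F) ∧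
        Steering.projSteeringViolation (Steering.maxEntangled d) F
          ≤ Steering.violationBound d) ∧
    -- scaling of the bound
    Asymptotics.IsEquivalent Filter.atTop Steering.violationBound
      (fun d : ℕ => (d : ℝ) / Real.log d) ∧
    -- Bell inequalities
    (∀ (d : ℕ), 1 ≤ d → ∀ (X Y A B : Type*) [Fintype X] [Fintype Y] [Fintype A] [Fintype B]
      (β : X → Y → A → B → ℝ), (∀ x y a b, 0 ≤ β x y a b) →
        BddAbove (Steering.lhvValues β) ∧
        ((∃ x y a b, β x y a b ≠ 0) → 0 < Steering.localBound β) ∧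
        BddAbove (Steering.projNonlocalityFractions (Steering.maxEntangled d) β) ∧
        Steering.projBellViolation (Steering.maxEntangled d) β
          ≤ Steering.violationBound d) := by
  refine ⟨fun d hd X A _ _ F hF => ?_, Steering.isEquivalent_violationBound,
    fun d hd X Y A B _ _ _ _ β hβ => ?_⟩
  · have h := fun r => Steering.steeringFraction_le_violationBound hd hF (r := r)
    exact ⟨Steering.bddAbove_lhsValues F, Steering.steeringBound_pos hF, ⟨_, h⟩,
      -- Nonnegativity covers an empty set of fractions (settings without outcomes), whose `sSup` is
      -- 0.
      Real.sSup_le h (Steering.violationBound_nonneg hd)⟩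
  · have h := fun r => Steering.nonlocalityFraction_le_violationBound hd hβ (r := r)
    exact ⟨Steering.bddAbove_lhvValues β, Steering.localBound_pos hβ, ⟨_, h⟩,
      Real.sSup_le h (Steering.violationBound_nonneg hd)⟩
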